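/- Let $(\Gamma,\mathcal F,\rho)$ be a probability space and let $V,H$ be separable real Hilbert spaces forming a Gelfand triple $(V,H,V')$, i.e. $V$ is a dense subspace of $H$ and $\|v\|_H\le C_{\mathrm P}\|v\|_V$ for all $v\in V$, with $C_{\mathrm P}>0$; elements $h\in H$ act on $V$ by $(h,v)_{V'V}=\langle h,v\rangle_H$. Let $L:\Gamma\to\mathfrak L(V,V')$ be Borel measurable and let $C_{\mathcal L},C_{\mathcal B}>0$ satisfy $(L(\omega)v,v)_{V'V}\ge C_{\mathcal L}\|v\|_V^2$ and $(L(\omega)v,w)_{V'V}\le C_{\mathcal B}\|v\|_V\|w\|_V$ for all $\omega\in\Gamma$ and $v,w\in V$. Put $\mathcal L(u)(\omega)=L(\omega)u(\omega)$, $\langle v,w\rangle_{\mathcal L,\rho}=\int_\Gamma(\mathcal L(v)(\omega),w(\omega))_{V'V}\,d\rho(\omega)$ and $\|v\|_{\mathcal L,\rho}=\langle v,v\rangle_{\mathcal L,\rho}^{1/2}$ for $v,w\in L^2_\rho(\Gamma;V)$; $\mathcal L$ is called symmetric if $\langle\cdot,\cdot\rangle_{\mathcal L,\rho}$ is symmetric.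 Write $\|\cdot\|_{H,L^2_\rho}$ and $\|\cdot\|_{V,L^2_\rho}$ for the norms of $L^2_\rho(\Gamma;H)$ and $L^2_\rho(\Gamma;V)$, $\mathbb E$ for the mean value and $v^*=v-\mathbb E[v]$. Let $T>0$ and $f\in L^2(0,T;L^2_\rho(\Gamma;H))$. A continuous dynamical low rank (DLR) solution of rank $R\ge 0$ of the random parabolic problem $\dot u+\mathcal L(u)=f$ is a function $u(t)=\bar u(t)+\sum_{j=1}^R U_j(t)Y_j(t)\in L^2_\rho(\Gamma;V)$, $t\in[0,T]$, with $\bar u(t),U_j(t)\in V$ and $Y_j(t)\in L^2_\rho(\Gamma)$, such that for all $t\in[0,T]$ the $U_j(t)$ are linearly independent, $\langle Y_i(t),Y_j(t)\rangle_{L^2_\rho}=\delta_{ij}$ and $\mathbb E[Y_j(t)]=0$, and for almost every $t\in(0,T]$ and all $j$ $$(\dot{\bar u},v)_{V'V}+(\mathbb E[\mathcal L(u)],v)_{V'V}=\langle\mathbb E[f],v\rangle_H\quad\forall v\in V,$$ $$(\dot U_j,v)_{V'V}+(\mathbb E[\mathcal L(u)Y_j],v)_{V'V}=\langle\mathbb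 E[fY_j],v\rangle_H\quad\forall v\in V,$$ $$\dot Y_j+\sum_{i=1}^R(M^{-1})_{ji}\,\mathcal P_{\mathcal Y}^\perp\big[(\mathcal L(u)^*,U_i)_{V'V}-\langle f^*,U_i\rangle_H\big]=0\quad\text{in }L^2_\rho(\Gamma),$$ where $M_{ij}=\langle U_i,U_j\rangle_H$ and $\mathcal P_{\mathcal Y}^\perp[g]=g-\sum_{k=1}^R\langle g,Y_k\rangle_{L^2_\rho}Y_k$. Here $\bar u,U_j$ are absolutely continuous with values in $V'$ and $Y_j$ is absolutely continuous with values in $L^2_\rho(\Gamma)$, in the sense that each equals its initial value plus the integral of its (Bochner integrable) time derivative. Theorem (stability of the continuous DLR solution). Let $u\in L^2(0,T;L^2_\rho(\Gamma;V))$ with $\dot u\in L^2(0,T;L^2_\rho(\Gamma;V))$ be a continuous DLR solution, with $u$ denoting its continuous representative in time. Then: 1. $\displaystyle\|u(T)\|_{H,L^2_\rho}^2+C_{\mathcal L}\int_0^T\|u(t)\|_{V,L^2_\rho}^2\,dt\le\|u(0)\|_{H,L^2_\rho}^2+\frac{C_{\mathrm P}^2}{C_{\mathcal L}}\int_0^T\|f(t)\|_{H,L^2_\rho}^2\,dt.$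 2. If $\mathcal L$ is symmetric, $\displaystyle\|u(T)\|_{\mathcal L,\rho}^2+\int_0^T\|\dot u(t)\|_{H,L^2_\rho}^2\,dt\le\|u(0)\|_{\mathcal L,\rho}^2+\int_0^T\|f(t)\|_{H,L^2_\rho}^2\,dt.$ If $f=0$, then for all $0\le t_1\le t_2\le T$: 3. $\|u(t_2)\|_{H,L^2_\rho}\le\|u(t_1)\|_{H,L^2_\rho}$; 4. if $\mathcal L$ is symmetric, $\|u(t_2)\|_{\mathcal L,\rho}\le\|u(t_1)\|_{\mathcal L,\rho}$. -/

import Mathlib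

open MeasureTheory Set

noncomputable section

/-- `w'` is the time derivative of `w` on `[0,T]`, where `w` is the absolutely continuous
representative: `w' ∈ L¹(0,T;X)` and `w(t) = w(0) + ∫₀ᵗ w'(s) ds` for every `t ∈ [0,T]`. -/
def HasTimeDeriv {X : Type*} [NormedAddCommGroup X] [NormedSpace ℝ X]
    (T : ℝ) (w w' : ℝ → X) : Prop :=
  IntegrableOn w' (Ioc 0 T) ∧ ∀ t ∈ Icc (0 : ℝ) T, w t = w 0 + ∫ s in (0 : ℝ)..t, w' s

/-- `w ∈ L²(0,T;X)`. -/
def IsL2Time {X : Type*} [NormedAddCommGroup X] (T : ℝ) (w : ℝ → X) : Prop :=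
  MemLp w 2 (volume.restrict (Ioc 0 T))

section

variable {Γ V H : Type*} [MeasurableSpace Γ]
  [NormedAddCommGroup V] [InnerProductSpace ℝ V]
  [NormedAddCommGroup H] [InnerProductSpace ℝ H]

/-- The embedding `H ↪ V'` of a Gelfand triple: `h ↦ ⟨h, · ⟩_H`, where `ι : V → H` is the
embedding of `V` into `H`. -/
def toDualOf (ι : V →L[ℝ] H) (h : H) : StrongDual ℝ V := (innerSL ℝ h).comp ι

/-- The element of `L²(Γ;H)` given by an element of `L²(Γ;V)`. -/
def embedL2 (ρ : Measure Γ) (ι : V →L[ℝ] H) (v : Lp V 2 ρ) : Lp H 2 ρ := ι.compLp v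

/-- The operator `𝓛` associated with the random operator `L`: `𝓛(u)(ω) = L(ω) u(ω)`. -/
def randOp (L : Γ → V →L[ℝ] StrongDual ℝ V) (u : Γ → V) (ω : Γ) : StrongDual ℝ V :=
  L ω (u ω)

/-- The bilinear form `⟨v, w⟩_{𝓛,ρ} = ∫ (𝓛(v)(ω), w(ω))_{V'V} dρ(ω)` on `L²(Γ;V)`. -/
def opForm (ρ : Measure Γ) (L : Γ → V →L[ℝ] StrongDual ℝ V) (v w : Lp V 2 ρ) : ℝ :=
  ∫ ω, randOp L v ω (w ω) ∂ρ

/-- The energy norm `‖v‖_{𝓛,ρ} = ⟨v, v⟩_{𝓛,ρ}^{1/2}`. -/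
def opNorm (ρ : Measure Γ) (L : Γ → V →L[ℝ] StrongDual ℝ V) (v : Lp V 2 ρ) : ℝ :=
  Real.sqrt (opForm ρ L v v)

/-- Mean value of a random variable (Bochner integral). -/
def mean {X : Type*} [NormedAddCommGroup X] [NormedSpace ℝ X] (ρ : Measure Γ) (v : Γ → X) : X :=
  ∫ ω, v ω ∂ρ

/-- The zero-mean part `v* = v - 𝔼[v]`. -/
def fluct {X : Type*} [NormedAddCommGroup X] [NormedSpace ℝ X] (ρ : Measure Γ) (v : Γ → X)
    (ω : Γ) : X :=
  v ω - mean ρ v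

/-- The expansion `ū + ∑ j, U_j Y_j` as an element of `L²(Γ;V)`. -/
def dlrExpansion (ρ : Measure Γ) [IsProbabilityMeasure ρ] {R : ℕ}
    (ubar : V) (U : Fin R → V) (Y : Fin R → Lp ℝ 2 ρ) : Lp V 2 ρ :=
  Lp.const 2 ρ ubar + ∑ j, (ContinuousLinearMap.toSpanSingleton ℝ (U j)).compLp (Y j)

/-- The Gram matrix `M_{ij} = ⟨U_i, U_j⟩_H`. -/
def gramH (ι : V →L[ℝ] H) {R : ℕ} (U : Fin R → V) : Matrix (Fin R) (Fin R) ℝ :=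
  Matrix.of fun i j => inner ℝ (ι (U i)) (ι (U j))

/-- `𝒫_𝒴^⊥[g] = g - ∑ k, ⟨g, Y_k⟩ Y_k`, the projection of `g ∈ L²(Γ)` on the orthogonal
complement of the span of the orthonormal functions `Y_k`. -/
def projPerp (ρ : Measure Γ) {R : ℕ} (Y : Fin R → Lp ℝ 2 ρ) (g : Γ → ℝ) (ω : Γ) : ℝ :=
  g ω - ∑ k, (∫ ω', g ω' * Y k ω' ∂ρ) * Y k ω

/-- The DLR system of rank `R` on `[0,T]`, in the dual dynamically orthogonal formulation,
for `u` and its factors `ū`, `U`, `Y` with time derivatives `dubar`, `dU` (in `V'`) and `dY` (in `L²(Γ)`). -/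
structure IsDLRSystem (ρ : Measure Γ) (ι : V →L[ℝ] H)
    (L : Γ → V →L[ℝ] StrongDual ℝ V) (f : ℝ → Lp H 2 ρ) (T : ℝ) (R : ℕ)
    (u : ℝ → Lp V 2 ρ) (ubar : ℝ → V) (U : ℝ → Fin R → V) (Y : ℝ → Fin R → Lp ℝ 2 ρ)
    (dubar : ℝ → StrongDual ℝ V) (dU : ℝ → Fin R → StrongDual ℝ V)
    (dY : ℝ → Fin R → Lp ℝ 2 ρ) : Prop where
  linIndep : ∀ t ∈ Icc (0 : ℝ) T, LinearIndependent ℝ (U t)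
  orthonormal : ∀ t ∈ Icc (0 : ℝ) T, Orthonormal ℝ (Y t)
  mean_zero : ∀ t ∈ Icc (0 : ℝ) T, ∀ j, mean ρ (Y t j) = 0
  deriv_ubar : HasTimeDeriv T (fun t => toDualOf ι (ι (ubar t))) dubar
  deriv_U : ∀ j, HasTimeDeriv T (fun t => toDualOf ι (ι (U t j))) (fun t => dU t j)
  deriv_Y : ∀ j, HasTimeDeriv T (fun t => Y t j) (fun t => dY t j)
  eq_ubar : ∀ᵐ t ∂(volume.restrict (Ioc 0 T)), ∀ v : V,
    dubar t v + mean ρ (randOp L (u t)) v = inner ℝ (mean ρ (f t)) (ι v)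
  eq_U : ∀ᵐ t ∂(volume.restrict (Ioc 0 T)), ∀ j, ∀ v : V,
    dU t j v + mean ρ (fun ω => Y t j ω • randOp L (u t) ω) v
      = inner ℝ (mean ρ (fun ω => Y t j ω • f t ω)) (ι v)
  eq_Y : ∀ᵐ t ∂(volume.restrict (Ioc 0 T)), ∀ j, ∀ᵐ ω ∂ρ,
    dY t j ω + ∑ i, (gramH ι (U t))⁻¹ j i *
      projPerp ρ (Y t) (fun ω' => fluct ρ (randOp L (u t)) ω' (U t i)
        - inner ℝ (fluct ρ (f t) ω') (ι (U t i))) ω = 0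

/-- `u` is a DLR solution of rank `R` on `[0,T]`: `u = ū + ∑ j, U_j Y_j` where `ū, U, Y` solve
the DLR system. -/
def IsDLRSolution (ρ : Measure Γ) [IsProbabilityMeasure ρ] (ι : V →L[ℝ] H)
    (L : Γ → V →L[ℝ] StrongDual ℝ V) (f : ℝ → Lp H 2 ρ) (T : ℝ) (R : ℕ)
    (u : ℝ → Lp V 2 ρ) : Prop :=
  ∃ (ubar : ℝ → V) (U : ℝ → Fin R → V) (Y : ℝ → Fin R → Lp ℝ 2 ρ)
    (dubar : ℝ → StrongDual ℝ V) (dU : ℝ → Fin R → StrongDual ℝ V)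
    (dY : ℝ → Fin R → Lp ℝ 2 ρ),
    (∀ t ∈ Icc (0 : ℝ) T, u t = dlrExpansion ρ (ubar t) (U t) (Y t)) ∧
    IsDLRSystem ρ ι L f T R u ubar U Y dubar dU dY

end

end

/-! The factor equations amount to one Galerkin condition: for almost every `t`, `u' + 𝓛(u) - f`
annihilates the tangent space of the rank-`R` manifold at `u(t)`. That space consists of the sums `b
⊗ 1 + ∑ (U_j ⊗ W_j + B_j ⊗ Y_j)` with each `W_j` of mean zero and orthogonal to all `Y_k`. It
contains `u` (take `W = 0`) and `u'` (product rule), so the low-rank solution may be tested with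
both, like the exact solution: `u` yields the `H` estimate, `u'` the energy-norm estimate, and
Young's inequality finishes each. `inner_dY_eq` removes the inverse Gram matrix and the projection
from the `Y` equation, `inner_embedL2_tangent` assembles the tested equations, and
`IsDLRSolution.ae_weak_form` combines them. The factors are differentiable only in `V'` a priori;
since `ū = 𝔼[u]` and `U_j = 𝔼[u Y_j]`, they inherit `V`-valued derivatives from `u` and `Y`.
`HasTimeDeriv.energy_le` integrates the resulting inequalities in time. -/

noncomputable section

/-! ### Absolutely continuous functions of time and quadratic energies -/

section Calculus

variable {X : Type*} [NormedAddCommGroup X] [NormedSpace ℝ X]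

theorem HasTimeDeriv.intervalIntegrable {T : ℝ} (hT : 0 < T) {w w' : ℝ → X}
    (h : HasTimeDeriv T w w') : IntervalIntegrable w' volume 0 T :=
  (intervalIntegrable_iff_integrableOn_Ioc_of_le hT.le).2 h.1

theorem HasTimeDeriv.ae_hasDerivAt [CompleteSpace X] {T : ℝ} (hT : 0 < T) {w w' : ℝ → X}
    (h : HasTimeDeriv T w w') :
    ∀ᵐ t ∂(volume.restrict (Ioc 0 T)), HasDerivAt w (w' t) t := by
  -- The integral representation says nothing beyond `T`, so a two-sided derivative is available
  -- only before it.
  have h₂ : ∀ᵐ x : ℝ, x ≠ T := by simp [ae_iff, measure_singleton]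
  rw [ae_restrict_iff' measurableSet_Ioc]
  filter_upwards [(h.intervalIntegrable hT).ae_hasDerivAt_integral, h₂] with t ht htT htI
  have htm : t ∈ uIcc 0 T := by rw [uIcc_of_le hT.le]; exact ⟨htI.1.le, htI.2⟩
  have hd := (ht htm 0 left_mem_uIcc).const_add (w 0)
  refine hd.congr_of_eventuallyEq ?_
  filter_upwards [Ioo_mem_nhds htI.1 (lt_of_le_of_ne htI.2 htT)] with s hs
  exact h.2 s ⟨hs.1.le, hs.2.le⟩

theorem HasTimeDeriv.sub_eq {T : ℝ} (hT : 0 < T) {w w' : ℝ → X} (h : HasTimeDeriv T w w')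
    {s t : ℝ} (hs : s ∈ Icc 0 T) (ht : t ∈ Icc 0 T) : w t - w s = ∫ r in s..t, w' r := by
  have hi : ∀ r ∈ Icc 0 T, IntervalIntegrable w' volume 0 r := fun r hr =>
    (h.intervalIntegrable hT).mono_set (by
      rw [uIcc_of_le hT.le, uIcc_of_le hr.1]; exact Icc_subset_Icc le_rfl hr.2)
  rw [h.2 t ht, h.2 s hs, add_sub_add_left_eq_sub,
    intervalIntegral.integral_interval_sub_left (hi t ht) (hi s hs)]

/-- The scalar primitive of `‖w'‖` serves as a majorant, so absolute continuity of vector-valued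
curves reduces to the real case. -/
theorem HasTimeDeriv.norm_sub_le {T : ℝ} (hT : 0 < T) {w w' : ℝ → X} (h : HasTimeDeriv T w w')
    {s t : ℝ} (hs : s ∈ Icc 0 T) (ht : t ∈ Icc 0 T) :
    ‖w t - w s‖ ≤ |(∫ r in (0 : ℝ)..t, ‖w' r‖) - ∫ r in (0 : ℝ)..s, ‖w' r‖| := by
  have hi : ∀ r ∈ Icc 0 T, IntervalIntegrable (fun r => ‖w' r‖) volume 0 r := fun r hr =>
    (h.intervalIntegrable hT).norm.mono_set (by
      rw [uIcc_of_le hT.le, uIcc_of_le hr.1]; exact Icc_subset_Icc le_rfl hr.2)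
  rw [h.sub_eq hT hs ht, intervalIntegral.integral_interval_sub_left (hi t ht) (hi s hs)]
  exact intervalIntegral.norm_integral_le_abs_integral_norm

theorem HasTimeDeriv.exists_norm_le {T : ℝ} (hT : 0 < T) {w w' : ℝ → X}
    (h : HasTimeDeriv T w w') : ∃ M, 0 ≤ M ∧ ∀ t ∈ Icc 0 T, ‖w t‖ ≤ M := by
  have h0 : (0 : ℝ) ∈ Icc 0 T := ⟨le_rfl, hT.le⟩
  refine ⟨‖w 0‖ + ∫ r in (0 : ℝ)..T, ‖w' r‖,
    add_nonneg (norm_nonneg _) (intervalIntegral.integral_nonneg hT.le fun _ _ => norm_nonneg _),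
    fun t ht => ?_⟩
  have h1 := h.norm_sub_le hT h0 ht
  have h2 : ‖w t‖ ≤ ‖w 0‖ + ‖w t - w 0‖ := by
    simpa using norm_add_le (w 0) (w t - w 0)
  have h3 : ∫ r in (0 : ℝ)..t, ‖w' r‖ ≤ ∫ r in (0 : ℝ)..T, ‖w' r‖ :=
    intervalIntegral.integral_mono_interval le_rfl ht.1 ht.2
      (Filter.Eventually.of_forall fun _ => norm_nonneg _) (h.intervalIntegrable hT).norm
  have h4 : 0 ≤ ∫ r in (0 : ℝ)..t, ‖w' r‖ :=
    intervalIntegral.integral_nonneg ht.1 fun _ _ => norm_nonneg _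
  rw [intervalIntegral.integral_same, sub_zero, abs_of_nonneg h4] at h1
  linarith

/-- A function whose increments are dominated by those of an absolutely continuous function is
absolutely continuous. -/
theorem AbsolutelyContinuousOnInterval.of_dist_le {Y Z : Type*} [PseudoMetricSpace Y]
    [PseudoMetricSpace Z] {g : ℝ → Y} {φ : ℝ → Z} {a b : ℝ}
    (hg : AbsolutelyContinuousOnInterval g a b) (C : ℝ)
    (h : ∀ x ∈ uIcc a b, ∀ y ∈ uIcc a b, dist (φ x) (φ y) ≤ C * dist (g x) (g y)) :
    AbsolutelyContinuousOnInterval φ a b := by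
  have := Filter.Tendsto.const_mul C hg
  rw [mul_zero] at this
  refine squeeze_zero' (Filter.Eventually.of_forall fun _ =>
    Finset.sum_nonneg fun _ _ => dist_nonneg) ?_ this
  have hE : ∀ᶠ E in AbsolutelyContinuousOnInterval.totalLengthFilter ⊓
      Filter.principal (AbsolutelyContinuousOnInterval.disjWithin a b),
      E ∈ AbsolutelyContinuousOnInterval.disjWithin a b :=
    Filter.eventually_inf_principal.mpr (by simp)
  filter_upwards [hE] with E hE
  rw [Finset.mul_sum]
  exact Finset.sum_le_sum fun i hi => h _ (hE.1 i hi).1 _ (hE.1 i hi).2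

theorem HasDerivAt.bilinear {Y Z : Type*} [NormedAddCommGroup Y] [NormedSpace ℝ Y]
    [NormedAddCommGroup Z] [NormedSpace ℝ Z] (B : X →L[ℝ] Y →L[ℝ] Z) {w : ℝ → X} {y : ℝ → Y}
    {w' : X} {y' : Y} {t : ℝ} (hw : HasDerivAt w w' t) (hy : HasDerivAt y y' t) :
    HasDerivAt (fun s => B (w s) (y s)) (B (w t) y' + B w' (y t)) t := by
  simpa using (B.hasFDerivAt_of_bilinear hw.hasFDerivAt hy.hasFDerivAt).hasDerivAt

/-- Integrated form of a differential inequality for a quadratic energy. -/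
theorem HasTimeDeriv.energy_le [CompleteSpace X] {T : ℝ} (hT : 0 < T) {w w' : ℝ → X}
    (h : HasTimeDeriv T w w') (B : X →L[ℝ] X →L[ℝ] ℝ) {a b : ℝ → ℝ}
    (ha : IntegrableOn a (Ioc 0 T)) (hb : IntegrableOn b (Ioc 0 T))
    (hab : ∀ᵐ t ∂(volume.restrict (Ioc 0 T)), B (w t) (w' t) + B (w' t) (w t) + a t ≤ b t)
    {t₁ t₂ : ℝ} (h₁ : t₁ ∈ Icc 0 T) (h₂ : t₂ ∈ Icc 0 T) (h₁₂ : t₁ ≤ t₂) :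
    B (w t₂) (w t₂) + ∫ t in t₁..t₂, a t ≤ B (w t₁) (w t₁) + ∫ t in t₁..t₂, b t := by
  have hsub : uIcc t₁ t₂ ⊆ Icc 0 T := by
    rw [uIcc_of_le h₁₂]; exact Icc_subset_Icc h₁.1 h₂.2
  have hsub' : Ioc t₁ t₂ ⊆ Ioc 0 T := Ioc_subset_Ioc h₁.1 h₂.2
  obtain ⟨M, hM0, hM⟩ := h.exists_norm_le hT
  have hN := ((h.intervalIntegrable hT).norm.absolutelyContinuousOnInterval_intervalIntegral
    (c := 0) left_mem_uIcc).mono (c := t₁) (d := t₂) (by rwa [uIcc_of_le hT.le])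
  have hφ : AbsolutelyContinuousOnInterval (fun t => B (w t) (w t)) t₁ t₂ := by
    refine hN.of_dist_le (2 * ‖B‖ * M) fun x hx y hy => ?_
    have hx := hsub hx
    have hy := hsub hy
    -- This splitting needs no symmetry of `B`; boundedness of `w` makes the energy's increments at
    -- most a constant times those of `w`.
    have e : B (w x) (w x) - B (w y) (w y) = B (w x - w y) (w x) + B (w y) (w x - w y) := by
      simp only [map_sub, sub_apply]; ring
    have hd := h.norm_sub_le hT hy hx
    rw [Real.dist_eq, Real.dist_eq, e]
    have i1 := B.le_opNorm₂ (w x - w y) (w x)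
    have i2 := B.le_opNorm₂ (w y) (w x - w y)
    have j1 : ‖B‖ * ‖w x - w y‖ * ‖w x‖ ≤ ‖B‖ * ‖w x - w y‖ * M := by gcongr; exact hM x hx
    have j2 : ‖B‖ * ‖w y‖ * ‖w x - w y‖ ≤ ‖B‖ * M * ‖w x - w y‖ := by gcongr; exact hM y hy
    calc |B (w x - w y) (w x) + B (w y) (w x - w y)|
        ≤ |B (w x - w y) (w x)| + |B (w y) (w x - w y)| := abs_add_le _ _
      _ ≤ 2 * ‖B‖ * M * ‖w x - w y‖ := by
        rw [Real.norm_eq_abs] at i1 i2; linarith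
      _ ≤ _ := by gcongr
  have hderiv : ∀ᵐ t ∂(volume.restrict (Ioc t₁ t₂)),
      deriv (fun t => B (w t) (w t)) t + a t ≤ b t := by
    filter_upwards [ae_restrict_of_ae_restrict_of_subset hsub' hab,
      ae_restrict_of_ae_restrict_of_subset hsub' (h.ae_hasDerivAt hT)] with t h1 h2
    rw [(HasDerivAt.bilinear B h2 h2).deriv]; exact h1
  have ia : IntervalIntegrable a volume t₁ t₂ :=
    (intervalIntegrable_iff_integrableOn_Ioc_of_le h₁₂).2 (ha.mono_set hsub')
  have ib : IntervalIntegrable b volume t₁ t₂ :=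
    (intervalIntegrable_iff_integrableOn_Ioc_of_le h₁₂).2 (hb.mono_set hsub')
  -- The almost-everywhere inequality suffices because the energy, being absolutely continuous, is
  -- recovered from its derivative.
  have hfin : ∫ t in t₁..t₂, (deriv (fun t => B (w t) (w t)) t + a t) ≤ ∫ t in t₁..t₂, b t := by
    rw [intervalIntegral.integral_of_le h₁₂, intervalIntegral.integral_of_le h₁₂]
    exact integral_mono_ae (hφ.intervalIntegrable_deriv.add ia).1 ib.1 hderiv
  rw [intervalIntegral.integral_add hφ.intervalIntegrable_deriv ia,
    hφ.integral_deriv_eq_sub] at hfin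
  linarith

omit [NormedSpace ℝ X] in
theorem IsL2Time.integrableOn_norm_sq {T : ℝ} {w : ℝ → X} (h : IsL2Time T w) :
    IntegrableOn (fun t => ‖w t‖ ^ 2) (Ioc 0 T) :=
  h.integrable_norm_pow two_ne_zero

end Calculus

/-! ### Elementary tensors and partial pairings in `L²(Γ;V)` -/

section Tensor

variable {Γ V H : Type*} [MeasurableSpace Γ]
  [NormedAddCommGroup V] [InnerProductSpace ℝ V]
  [NormedAddCommGroup H] [InnerProductSpace ℝ H]

/-- The elementary tensor `v ⊗ Y ∈ L²(Γ;V)` of `v ∈ V` and `Y ∈ L²(Γ)`. -/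
def tensorL2 (V : Type*) [NormedAddCommGroup V] [InnerProductSpace ℝ V] (ρ : Measure Γ) :
    V →L[ℝ] Lp ℝ 2 ρ →L[ℝ] Lp V 2 ρ :=
  (ContinuousLinearMap.lsmul ℝ ℝ (E := V)).flip.compLpL₂ 2 ρ

/-- The pairing `(u, Y) ↦ 𝔼[u Y]`. -/
def pairL2 (V : Type*) [NormedAddCommGroup V] [InnerProductSpace ℝ V] [CompleteSpace V]
    (ρ : Measure Γ) : Lp V 2 ρ →L[ℝ] Lp ℝ 2 ρ →L[ℝ] V :=
  (ContinuousLinearMap.lsmul ℝ ℝ (E := V)).flip.lpPairing ρ 2 2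

/-- The constant function `1` in `L²(Γ)`. -/
def oneL2 (ρ : Measure Γ) [IsProbabilityMeasure ρ] : Lp ℝ 2 ρ := Lp.const 2 ρ 1

variable (ρ : Measure Γ)

theorem tensorL2_apply (v : V) (Y : Lp ℝ 2 ρ) :
    tensorL2 V ρ v Y = (ContinuousLinearMap.toSpanSingleton ℝ v).compLp Y := by
  rw [tensorL2, ContinuousLinearMap.compLpL₂_apply_apply,
    ContinuousLinearMap.lsmul_flip_apply]

theorem coeFn_tensorL2 (v : V) (Y : Lp ℝ 2 ρ) :
    tensorL2 V ρ v Y =ᵐ[ρ] fun ω => Y ω • v := by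
  rw [tensorL2_apply]
  exact ContinuousLinearMap.coeFn_compLp' _ _

theorem pairL2_apply [CompleteSpace V] (u : Lp V 2 ρ) (Y : Lp ℝ 2 ρ) :
    pairL2 V ρ u Y = ∫ ω, Y ω • u ω ∂ρ := by
  rw [pairL2, ContinuousLinearMap.lpPairing_eq_integral]
  rfl

theorem innerL2_eq (Y Z : Lp ℝ 2 ρ) : inner ℝ Y Z = ∫ ω, Y ω * Z ω ∂ρ := by
  rw [L2.inner_def]
  refine integral_congr_ae (Filter.Eventually.of_forall fun ω => ?_)
  simp [mul_comm]

theorem integrable_smul_L2 (Y : Lp ℝ 2 ρ) (u : Lp V 2 ρ) :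
    Integrable (fun ω => Y ω • u ω) ρ :=
  memLp_one_iff_integrable.1 ((Lp.memLp u).smul (Lp.memLp Y))

/-- This contraction reads off the coefficients of an expansion in orthonormal random variables. -/
theorem pairL2_tensorL2 [CompleteSpace V] (v : V) (Y Z : Lp ℝ 2 ρ) :
    pairL2 V ρ (tensorL2 V ρ v Y) Z = (inner ℝ Y Z : ℝ) • v := by
  rw [pairL2_apply, innerL2_eq, ← integral_smul_const]
  refine integral_congr_ae ?_
  filter_upwards [coeFn_tensorL2 ρ v Y] with ω h
  rw [h, smul_smul, mul_comm]

/-- `embedL2` as a continuous linear map. -/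
def embedL2L (ι : V →L[ℝ] H) : Lp V 2 ρ →L[ℝ] Lp H 2 ρ := ι.compLpL 2 ρ

theorem embedL2L_apply (ι : V →L[ℝ] H) (v : Lp V 2 ρ) : embedL2L ρ ι v = embedL2 ρ ι v := rfl

theorem coeFn_embedL2 (ι : V →L[ℝ] H) (v : Lp V 2 ρ) :
    embedL2 ρ ι v =ᵐ[ρ] fun ω => ι (v ω) := ContinuousLinearMap.coeFn_compLp' _ _

theorem embedL2_tensorL2 (ι : V →L[ℝ] H) (v : V) (Y : Lp ℝ 2 ρ) :
    embedL2 ρ ι (tensorL2 V ρ v Y) = tensorL2 H ρ (ι v) Y := by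
  refine Lp.ext ?_
  filter_upwards [coeFn_embedL2 ρ ι (tensorL2 V ρ v Y), coeFn_tensorL2 ρ v Y,
    coeFn_tensorL2 ρ (ι v) Y] with ω h1 h2 h3
  rw [h1, h2, h3, map_smul]

theorem inner_tensorL2_right (h : Lp H 2 ρ) (v : H) (Y : Lp ℝ 2 ρ) :
    inner ℝ h (tensorL2 H ρ v Y) = ∫ ω, Y ω * inner ℝ (h ω) v ∂ρ := by
  rw [L2.inner_def]
  refine integral_congr_ae ?_
  filter_upwards [coeFn_tensorL2 ρ v Y] with ω h1
  rw [h1, inner_smul_right]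

/-- Adjointness of pairing and tensoring: it turns the averaged forcing in the factor equations into
a test against an elementary tensor. -/
theorem inner_pairL2 [CompleteSpace H] (h : Lp H 2 ρ) (v : H) (Y : Lp ℝ 2 ρ) :
    inner ℝ (pairL2 H ρ h Y) v = (inner ℝ h (tensorL2 H ρ v Y) : ℝ) := by
  rw [inner_tensorL2_right, pairL2_apply, real_inner_comm,
    ← integral_inner (integrable_smul_L2 ρ Y h)]
  refine integral_congr_ae (Filter.Eventually.of_forall fun ω => ?_)
  simp only [inner_smul_right, real_inner_comm]

theorem inner_tensorL2_tensorL2 [CompleteSpace H] (v w : H) (Y Z : Lp ℝ 2 ρ) :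
    (inner ℝ (tensorL2 H ρ v Y) (tensorL2 H ρ w Z) : ℝ) = inner ℝ v w * inner ℝ Y Z := by
  rw [← inner_pairL2, pairL2_tensorL2, inner_smul_left]
  simp [mul_comm]

theorem norm_embedL2_le (ι : V →L[ℝ] H) {C : ℝ} (hι : ∀ v, ‖ι v‖ ≤ C * ‖v‖) (v : Lp V 2 ρ) :
    ‖embedL2 ρ ι v‖ ≤ C * ‖v‖ := by
  refine Lp.norm_le_mul_norm_of_ae_le_mul ?_
  filter_upwards [coeFn_embedL2 ρ ι v] with ω h
  rw [h]; exact hι _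

variable [IsProbabilityMeasure ρ]

theorem coeFn_oneL2 : oneL2 ρ =ᵐ[ρ] fun _ => (1 : ℝ) := Lp.coeFn_const ..

theorem tensorL2_one (v : V) : tensorL2 V ρ v (oneL2 ρ) = Lp.const 2 ρ v := by
  refine Lp.ext ?_
  filter_upwards [coeFn_tensorL2 ρ v (oneL2 ρ), coeFn_oneL2 ρ,
    Lp.coeFn_const 2 ρ v] with ω h1 h2 h3
  rw [h1, h2, h3, one_smul, Function.const_apply]

theorem inner_oneL2 (Y : Lp ℝ 2 ρ) : (inner ℝ (oneL2 ρ) Y : ℝ) = mean ρ Y := by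
  rw [innerL2_eq, mean]
  refine integral_congr_ae ?_
  filter_upwards [coeFn_oneL2 ρ] with ω h
  rw [h, one_mul]

theorem inner_oneL2_self : (inner ℝ (oneL2 ρ) (oneL2 ρ) : ℝ) = 1 := by
  rw [inner_oneL2, mean, integral_congr_ae (coeFn_oneL2 ρ)]
  simp

theorem dlrExpansion_eq {R : ℕ} (a : V) (U : Fin R → V) (Y : Fin R → Lp ℝ 2 ρ) :
    dlrExpansion ρ a U Y = tensorL2 V ρ a (oneL2 ρ) + ∑ j, tensorL2 V ρ (U j) (Y j) := by
  rw [dlrExpansion, tensorL2_one]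
  simp only [tensorL2_apply]

omit [IsProbabilityMeasure ρ] in
/-- The pointwise projection `projPerp` represents the projection in `L²(Γ)`. -/
theorem projPerp_ae {R : ℕ} (Y : Fin R → Lp ℝ 2 ρ) (G : Lp ℝ 2 ρ) {g : Γ → ℝ} (hg : g =ᵐ[ρ] G) :
    projPerp ρ Y g =ᵐ[ρ] (G - ∑ k, (inner ℝ G (Y k) : ℝ) • Y k : Lp ℝ 2 ρ) := by
  have hs : ∀ᵐ ω ∂ρ, ∀ k, ((inner ℝ G (Y k) : ℝ) • Y k : Lp ℝ 2 ρ) ω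
      = (inner ℝ G (Y k) : ℝ) * Y k ω :=
    ae_all_iff.2 fun k => by
      filter_upwards [Lp.coeFn_smul (inner ℝ G (Y k) : ℝ) (Y k)] with ω h
      rw [h]; rfl
  filter_upwards [hs, hg, Lp.coeFn_sub G (∑ k, (inner ℝ G (Y k) : ℝ) • Y k),
    Lp.coeFn_finsetSum Finset.univ (fun k => (inner ℝ G (Y k) : ℝ) • Y k)] with ω h1 h2 h3 h4
  rw [h3, Pi.sub_apply, h4, projPerp, h2]
  simp only [Finset.sum_apply, h1]
  congr 1
  refine Finset.sum_congr rfl fun k _ => ?_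
  rw [innerL2_eq]
  congr 1
  refine integral_congr_ae ?_
  filter_upwards [hg] with ω' h; rw [h]

end Tensor

/-! ### The random operator and its bilinear form -/

section Operator

variable {Γ V : Type*} [MeasurableSpace Γ]
  [NormedAddCommGroup V] [InnerProductSpace ℝ V] [CompleteSpace V]
  [TopologicalSpace.SeparableSpace V]
  {ρ : Measure Γ} {L : Γ → V →L[ℝ] StrongDual ℝ V} {CB : ℝ}

omit [MeasurableSpace Γ] [CompleteSpace V] [TopologicalSpace.SeparableSpace V] in
theorem norm_apply_le_of_bound (hCB : 0 < CB) (hbound : ∀ ω v w, L ω v w ≤ CB * ‖v‖ * ‖w‖)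
    (ω : Γ) (v : V) : ‖L ω v‖ ≤ CB * ‖v‖ := by
  refine ContinuousLinearMap.opNorm_le_bound _ (by positivity) fun w => ?_
  rw [Real.norm_eq_abs, abs_le]
  refine ⟨?_, hbound ω v w⟩
  -- The assumed bound is one-sided; testing with `-w` gives the other side.
  have := hbound ω v (-w)
  rw [map_neg, norm_neg] at this
  linarith

/-- A Carathéodory argument: `L ω v` is continuous in `v` and measurable in `ω`, hence jointly
measurable. Separability of `V'` comes from that of `V` through the Riesz isomorphism. -/
theorem aestronglyMeasurable_randOp (hL : Measurable L) (u : Lp V 2 ρ) :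
    AEStronglyMeasurable (randOp L u) ρ := by
  borelize V
  have : SecondCountableTopology V := UniformSpace.secondCountable_of_separable V
  have : TopologicalSpace.SeparableSpace (StrongDual ℝ V) :=
    (InnerProductSpace.toDual ℝ V).surjective.denseRange.separableSpace
      (InnerProductSpace.toDual ℝ V).continuous
  have : SecondCountableTopology (StrongDual ℝ V) :=
    UniformSpace.secondCountable_of_separable _
  have h1 : StronglyMeasurable (Function.uncurry fun (v : V) ω => L ω v) :=
    stronglyMeasurable_uncurry_of_continuous_of_stronglyMeasurable
      (fun ω => (L ω).continuous)
      (fun v => (hL.apply_continuousLinearMap v).stronglyMeasurable)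
  exact (h1.comp_measurable
    ((Lp.stronglyMeasurable u).measurable.prodMk measurable_id)).aestronglyMeasurable

theorem memLp_randOp (hL : Measurable L) (hCB : 0 < CB)
    (hbound : ∀ ω v w, L ω v w ≤ CB * ‖v‖ * ‖w‖) (u : Lp V 2 ρ) :
    MemLp (randOp L u) 2 ρ :=
  (Lp.memLp u).of_le_mul (aestronglyMeasurable_randOp hL u)
    (Filter.Eventually.of_forall fun ω => norm_apply_le_of_bound hCB hbound ω (u ω))

/-- The operator `𝓛 : L²(Γ;V) → L²(Γ;V')`. -/
def randOpL2 (ρ : Measure Γ) (hL : Measurable L) (hCB : 0 < CB)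
    (hbound : ∀ ω v w, L ω v w ≤ CB * ‖v‖ * ‖w‖) : Lp V 2 ρ →L[ℝ] Lp (StrongDual ℝ V) 2 ρ :=
  LinearMap.mkContinuous
    { toFun := fun u => (memLp_randOp hL hCB hbound u).toLp _
      map_add' := fun u v => by
        rw [← MemLp.toLp_add, MemLp.toLp_eq_toLp_iff]
        filter_upwards [Lp.coeFn_add u v] with ω h
        simp only [randOp, h, Pi.add_apply, map_add]
      map_smul' := fun c u => by
        rw [RingHom.id_apply, ← MemLp.toLp_const_smul, MemLp.toLp_eq_toLp_iff]
        filter_upwards [Lp.coeFn_smul c u] with ω h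
        simp only [randOp, h, Pi.smul_apply, map_smul] } CB fun u => by
    refine Lp.norm_le_mul_norm_of_ae_le_mul ?_
    filter_upwards [(memLp_randOp hL hCB hbound u).coeFn_toLp] with ω h
    exact h ▸ norm_apply_le_of_bound hCB hbound ω (u ω)

theorem coeFn_randOpL2 (hL : Measurable L) (hCB : 0 < CB)
    (hbound : ∀ ω v w, L ω v w ≤ CB * ‖v‖ * ‖w‖) (u : Lp V 2 ρ) :
    randOpL2 ρ hL hCB hbound u =ᵐ[ρ] randOp L u :=
  (memLp_randOp hL hCB hbound u).coeFn_toLp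

/-- `opForm` as a continuous bilinear form. -/
def opFormL (ρ : Measure Γ) (hL : Measurable L) (hCB : 0 < CB)
    (hbound : ∀ ω v w, L ω v w ≤ CB * ‖v‖ * ‖w‖) : Lp V 2 ρ →L[ℝ] Lp V 2 ρ →L[ℝ] ℝ :=
  ((ContinuousLinearMap.id ℝ (StrongDual ℝ V)).lpPairing ρ 2 2).comp
    (randOpL2 ρ hL hCB hbound)

theorem opFormL_apply (hL : Measurable L) (hCB : 0 < CB)
    (hbound : ∀ ω v w, L ω v w ≤ CB * ‖v‖ * ‖w‖) (u v : Lp V 2 ρ) :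
    opFormL ρ hL hCB hbound u v = opForm ρ L u v := by
  rw [opFormL, ContinuousLinearMap.comp_apply, ContinuousLinearMap.lpPairing_eq_integral]
  refine integral_congr_ae ?_
  filter_upwards [coeFn_randOpL2 hL hCB hbound u] with ω h
  rw [h]; rfl

theorem opForm_tensorL2 (hL : Measurable L) (hCB : 0 < CB)
    (hbound : ∀ ω v w, L ω v w ≤ CB * ‖v‖ * ‖w‖) (u : Lp V 2 ρ) (v : V) (Y : Lp ℝ 2 ρ) :
    opForm ρ L u (tensorL2 V ρ v Y) = mean ρ (fun ω => Y ω • randOp L u ω) v := by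
  have hi : Integrable (fun ω => Y ω • randOp L u ω) ρ :=
    memLp_one_iff_integrable.1 ((memLp_randOp hL hCB hbound u).smul (Lp.memLp Y))
  rw [mean, ContinuousLinearMap.integral_apply hi, opForm]
  refine integral_congr_ae ?_
  filter_upwards [coeFn_tensorL2 ρ v Y] with ω h
  rw [h, map_smul]; rfl

theorem le_opForm {CL : ℝ} (hL : Measurable L) (hCB : 0 < CB)
    (hbound : ∀ ω v w, L ω v w ≤ CB * ‖v‖ * ‖w‖) (hcoer : ∀ ω v, CL * ‖v‖ ^ 2 ≤ L ω v v)
    (u : Lp V 2 ρ) : CL * ‖u‖ ^ 2 ≤ opForm ρ L u u := by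
  have h2 : ‖u‖ ^ 2 = ∫ ω, ‖u ω‖ ^ 2 ∂ρ := by
    rw [← real_inner_self_eq_norm_sq, L2.inner_def]
    simp only [real_inner_self_eq_norm_sq]
  rw [h2, ← integral_const_mul]
  refine integral_mono ((Lp.memLp u).integrable_norm_pow two_ne_zero |>.const_mul _) ?_
    fun ω => hcoer ω _
  refine (((Lp.memLp u).integrable_norm_pow two_ne_zero).const_mul CB).mono' ?_
    (Filter.Eventually.of_forall fun ω => ?_)
  · exact ContinuousLinearMap.aestronglyMeasurable_comp₂ (ContinuousLinearMap.id ℝ _)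
      (aestronglyMeasurable_randOp hL u) (Lp.aestronglyMeasurable u)
  · refine ((randOp L u ω).le_opNorm _).trans ?_
    have := norm_apply_le_of_bound hCB hbound ω (u ω)
    calc _ ≤ CB * ‖u ω‖ * ‖u ω‖ := by gcongr; exact this
      _ = _ := by ring

theorem opNorm_sq {CL : ℝ} (hCL : 0 < CL) (hL : Measurable L) (hCB : 0 < CB)
    (hbound : ∀ ω v w, L ω v w ≤ CB * ‖v‖ * ‖w‖) (hcoer : ∀ ω v, CL * ‖v‖ ^ 2 ≤ L ω v v)
    (u : Lp V 2 ρ) : opNorm ρ L u ^ 2 = opForm ρ L u u :=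
  Real.sq_sqrt ((by positivity : 0 ≤ CL * ‖u‖ ^ 2).trans (le_opForm hL hCB hbound hcoer u))

end Operator

/-! ### Tangent directions at a fixed time -/

section Static

variable {Γ V H : Type*} [MeasurableSpace Γ]
  [NormedAddCommGroup V] [InnerProductSpace ℝ V]
  [NormedAddCommGroup H] [InnerProductSpace ℝ H] [CompleteSpace H]
  (ρ : Measure Γ) [IsProbabilityMeasure ρ] {R : ℕ}

omit [CompleteSpace H] [NormedAddCommGroup H] [InnerProductSpace ℝ H] in
theorem pairL2_expansion_one [CompleteSpace V] (a : V) (U : Fin R → V) (Y : Fin R → Lp ℝ 2 ρ)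
    (hm : ∀ j, (inner ℝ (oneL2 ρ) (Y j) : ℝ) = 0) :
    pairL2 V ρ (tensorL2 V ρ a (oneL2 ρ) + ∑ j, tensorL2 V ρ (U j) (Y j)) (oneL2 ρ) = a := by
  simp only [map_add, map_sum, add_apply, sum_apply, pairL2_tensorL2, inner_oneL2_self, one_smul]
  have hm' : ∀ j, (inner ℝ (Y j) (oneL2 ρ) : ℝ) = 0 := fun j => by rw [real_inner_comm, hm]
  simp [hm']

omit [CompleteSpace H] [NormedAddCommGroup H] [InnerProductSpace ℝ H] in
theorem pairL2_expansion [CompleteSpace V] (a : V) (U : Fin R → V) (Y : Fin R → Lp ℝ 2 ρ)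
    (ho : Orthonormal ℝ Y) (hm : ∀ j, (inner ℝ (oneL2 ρ) (Y j) : ℝ) = 0) (k : Fin R) :
    pairL2 V ρ (tensorL2 V ρ a (oneL2 ρ) + ∑ j, tensorL2 V ρ (U j) (Y j)) (Y k) = U k := by
  classical
  simp only [map_add, map_sum, add_apply, sum_apply, pairL2_tensorL2, hm,
    orthonormal_iff_ite.1 ho]
  simp

/-- An element of `L²(Γ;V)` in the tangent space at `ū + ∑ U_j Y_j` satisfying the weak equations
for the three kinds of directions satisfies the weak equation for all tangent directions. -/
theorem inner_embedL2_tangent (ι : V →L[ℝ] H) (F : Lp V 2 ρ →L[ℝ] ℝ)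
    (a' : V) (U U' : Fin R → V) (Y Y' : Fin R → Lp ℝ 2 ρ)
    (ho : Orthonormal ℝ Y) (hm : ∀ j, (inner ℝ (oneL2 ρ) (Y j) : ℝ) = 0)
    (hm' : ∀ j, (inner ℝ (oneL2 ρ) (Y' j) : ℝ) = 0)
    (hY' : ∀ k j, (inner ℝ (Y k) (Y' j) : ℝ) = 0)
    (h1 : ∀ v, inner ℝ (ι a') (ι v) = F (tensorL2 V ρ v (oneL2 ρ)))
    (h2 : ∀ k v, inner ℝ (ι (U' k)) (ι v) = F (tensorL2 V ρ v (Y k)))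
    (h3 : ∀ k (W : Lp ℝ 2 ρ), (inner ℝ (oneL2 ρ) W : ℝ) = 0 → (∀ i, (inner ℝ (Y i) W : ℝ) = 0) →
      ∑ i, inner ℝ (ι (U i)) (ι (U k)) * (inner ℝ (Y' i) W : ℝ) = F (tensorL2 V ρ (U k) W))
    (b : V) (B : Fin R → V) (W : Fin R → Lp ℝ 2 ρ)
    (hW1 : ∀ j, (inner ℝ (oneL2 ρ) (W j) : ℝ) = 0)
    (hWY : ∀ k j, (inner ℝ (Y k) (W j) : ℝ) = 0) {u' v : Lp V 2 ρ}
    (hu' : u' = tensorL2 V ρ a' (oneL2 ρ) + ∑ j, (tensorL2 V ρ (U j) (Y' j)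
      + tensorL2 V ρ (U' j) (Y j)))
    (hv : v = tensorL2 V ρ b (oneL2 ρ) + ∑ j, (tensorL2 V ρ (U j) (W j)
      + tensorL2 V ρ (B j) (Y j))) :
    inner ℝ (embedL2 ρ ι u') (embedL2 ρ ι v) = F v := by
  classical
  have sw : ∀ X Z : Lp ℝ 2 ρ, (inner ℝ X Z : ℝ) = 0 → (inner ℝ Z X : ℝ) = 0 :=
    fun X Z h => by rw [real_inner_comm]; exact h
  -- Orthogonality among `1`, `Y` and the directions `Y'`, `W` leaves one block of this expansion in
  -- each case: `a'` for `Z = 1`, `U'_k` for `Z = Y_k`, and the terms in `Y'` for `Z = W_k`.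
  have key : ∀ (w : V) (Z : Lp ℝ 2 ρ), (inner ℝ (embedL2 ρ ι u') (embedL2 ρ ι (tensorL2 V ρ w Z)) : ℝ)
      = inner ℝ (ι a') (ι w) * inner ℝ (oneL2 ρ) Z
        + ∑ j, (inner ℝ (ι (U j)) (ι w) * inner ℝ (Y' j) Z
          + inner ℝ (ι (U' j)) (ι w) * inner ℝ (Y j) Z) := by
    intro w Z
    rw [hu', ← embedL2L_apply]
    simp only [map_add, map_sum, embedL2L_apply, embedL2_tensorL2, inner_add_left, sum_inner,
      inner_tensorL2_tensorL2]
  have k1 : ∀ w, (inner ℝ (embedL2 ρ ι u') (embedL2 ρ ι (tensorL2 V ρ w (oneL2 ρ))) : ℝ)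
      = F (tensorL2 V ρ w (oneL2 ρ)) := by
    intro w
    rw [key, inner_oneL2_self, ← h1]
    simp [sw _ _ (hm _), sw _ _ (hm' _)]
  have k2 : ∀ k w, (inner ℝ (embedL2 ρ ι u') (embedL2 ρ ι (tensorL2 V ρ w (Y k))) : ℝ)
      = F (tensorL2 V ρ w (Y k)) := by
    intro k w
    rw [key, ← h2]
    simp [hm, sw _ _ (hY' _ _), orthonormal_iff_ite.1 ho]
  have k3 : ∀ k, (inner ℝ (embedL2 ρ ι u') (embedL2 ρ ι (tensorL2 V ρ (U k) (W k))) : ℝ)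
      = F (tensorL2 V ρ (U k) (W k)) := by
    intro k
    rw [key, ← h3 k (W k) (hW1 k) (fun i => hWY i k)]
    simp [hW1, hWY]
  have hv' := congrArg (embedL2L ρ ι) hv
  rw [embedL2L_apply] at hv'
  rw [hv', hv]
  simp only [map_add, map_sum, embedL2L_apply, inner_add_right, inner_sum, k1, k2, k3]

omit [IsProbabilityMeasure ρ] in
variable {ρ} in
/-- The coefficient equations determine the derivatives of the `Y_j` in `L²(Γ)`. -/
theorem inner_dY_eq {Y dY : Fin R → Lp ℝ 2 ρ} (ho : Orthonormal ℝ Y)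
    {M : Matrix (Fin R) (Fin R) ℝ} (hM : IsUnit M.det) (G : Fin R → Lp ℝ 2 ρ)
    {g : Fin R → Γ → ℝ} (hg : ∀ i, g i =ᵐ[ρ] G i)
    (heq : ∀ j, ∀ᵐ ω ∂ρ, dY j ω + ∑ i, M⁻¹ j i * projPerp ρ Y (g i) ω = 0) :
    (∀ k j, (inner ℝ (Y k) (dY j) : ℝ) = 0) ∧
    ∀ k (W : Lp ℝ 2 ρ), (∀ i, (inner ℝ (Y i) W : ℝ) = 0) →
      ∑ i, M k i * (inner ℝ (dY i) W : ℝ) = -inner ℝ (G k) W := by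
  classical
  set P : Fin R → Lp ℝ 2 ρ := fun i => G i - ∑ k, (inner ℝ (G i) (Y k) : ℝ) • Y k with hP
  have hd : ∀ j, dY j = -∑ i, M⁻¹ j i • P i := by
    intro j
    refine Lp.ext ?_
    have hs : ∀ᵐ ω ∂ρ, ∀ i, (M⁻¹ j i • P i : Lp ℝ 2 ρ) ω = M⁻¹ j i * projPerp ρ Y (g i) ω :=
      ae_all_iff.2 fun i => by
        filter_upwards [Lp.coeFn_smul (M⁻¹ j i) (P i), projPerp_ae ρ Y (G i) (hg i)] with ω h h'
        rw [h, h']; rfl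
    filter_upwards [heq j, hs, Lp.coeFn_neg (∑ i, M⁻¹ j i • P i),
      Lp.coeFn_finsetSum Finset.univ (fun i => M⁻¹ j i • P i)] with ω h1 h2 h3 h4
    rw [h3, Pi.neg_apply, h4, Finset.sum_apply, Finset.sum_congr rfl fun i _ => h2 i]
    linarith
  constructor
  · intro k j
    rw [hd, inner_neg_right, inner_sum, neg_eq_zero]
    refine Finset.sum_eq_zero fun i _ => ?_
    rw [inner_smul_right, hP]
    simp [inner_sub_right, inner_sum, inner_smul_right, orthonormal_iff_ite.1 ho,
      real_inner_comm]
  · intro k W hW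
    -- The projection is invisible to a `W` orthogonal to every `Y_k`.
    have hPW : ∀ i, (inner ℝ (P i) W : ℝ) = inner ℝ (G i) W := by
      intro i
      simp [hP, inner_sub_left, sum_inner, inner_smul_left, hW]
    have : ∀ i, (inner ℝ (dY i) W : ℝ) = -(M⁻¹.mulVec (fun l => inner ℝ (G l) W)) i := by
      intro i
      rw [hd, inner_neg_left, sum_inner]
      simp [inner_smul_left, hPW, Matrix.mulVec, dotProduct]
    have h2 : M.mulVec (M⁻¹.mulVec (fun l => (inner ℝ (G l) W : ℝ))) = fun l => inner ℝ (G l) W := by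
      rw [Matrix.mulVec_mulVec, Matrix.mul_nonsing_inv _ hM, Matrix.one_mulVec]
    simp only [this, mul_neg, Finset.sum_neg_distrib]
    rw [← congrFun h2 k]; rfl

-- Injectivity of `ι` carries linear independence from `V` to `H`, where the Gram matrix is then
-- positive definite.
omit [MeasurableSpace Γ] [CompleteSpace H] in
theorem isUnit_det_gramH (ι : V →L[ℝ] H) (hι : Function.Injective ι) {U : Fin R → V}
    (hU : LinearIndependent ℝ U) : IsUnit (gramH ι U).det := by
  have h : LinearIndependent ℝ (fun i => ι (U i)) :=
    hU.map' (ι : V →ₗ[ℝ] H) (LinearMap.ker_eq_bot.2 hι)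
  exact (Matrix.posDef_gram_of_linearIndependent h).det_pos.ne'.isUnit

end Static

/-! ### The scalar residual driving the `Y` equation -/

section Residual

variable {Γ V H : Type*} [MeasurableSpace Γ]
  [NormedAddCommGroup V] [InnerProductSpace ℝ V] [CompleteSpace V]
  [TopologicalSpace.SeparableSpace V]
  [NormedAddCommGroup H] [InnerProductSpace ℝ H]
  {ρ : Measure Γ} {L : Γ → V →L[ℝ] StrongDual ℝ V} {CB : ℝ}

/-- The random variable `(𝓛(u), v)_{V'V} - ⟨f, v⟩_H`. -/
def residualL2 (hL : Measurable L) (hCB : 0 < CB)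
    (hbound : ∀ ω v w, L ω v w ≤ CB * ‖v‖ * ‖w‖) (ι : V →L[ℝ] H) (f : Lp H 2 ρ)
    (u : Lp V 2 ρ) (v : V) : Lp ℝ 2 ρ :=
  (ContinuousLinearMap.apply ℝ ℝ v).compLp (randOpL2 ρ hL hCB hbound u)
    - (innerSL ℝ (ι v)).compLp f

theorem coeFn_residualL2 (hL : Measurable L) (hCB : 0 < CB)
    (hbound : ∀ ω v w, L ω v w ≤ CB * ‖v‖ * ‖w‖) (ι : V →L[ℝ] H) (f : Lp H 2 ρ)
    (u : Lp V 2 ρ) (v : V) :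
    residualL2 hL hCB hbound ι f u v =ᵐ[ρ] fun ω => randOp L u ω v - inner ℝ (f ω) (ι v) := by
  rw [residualL2]
  filter_upwards [Lp.coeFn_sub ((ContinuousLinearMap.apply ℝ ℝ v).compLp
      (randOpL2 ρ hL hCB hbound u)) ((innerSL ℝ (ι v)).compLp f),
    ContinuousLinearMap.coeFn_compLp' (ContinuousLinearMap.apply ℝ ℝ v)
      (randOpL2 ρ hL hCB hbound u),
    ContinuousLinearMap.coeFn_compLp' (innerSL ℝ (ι v)) f,
    coeFn_randOpL2 hL hCB hbound u] with ω h1 h2 h3 h4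
  rw [h1, Pi.sub_apply, h2, h3, h4, innerSL_apply_apply, real_inner_comm]
  rfl

theorem inner_residualL2 (hL : Measurable L) (hCB : 0 < CB)
    (hbound : ∀ ω v w, L ω v w ≤ CB * ‖v‖ * ‖w‖) (ι : V →L[ℝ] H) (f : Lp H 2 ρ)
    (u : Lp V 2 ρ) (v : V) (W : Lp ℝ 2 ρ) :
    (inner ℝ (residualL2 hL hCB hbound ι f u v) W : ℝ)
      = opForm ρ L u (tensorL2 V ρ v W) - inner ℝ f (embedL2 ρ ι (tensorL2 V ρ v W)) := by
  rw [residualL2, inner_sub_left, embedL2_tensorL2, inner_tensorL2_right, innerL2_eq,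
    innerL2_eq, opForm]
  congr 1
  · refine integral_congr_ae ?_
    filter_upwards [ContinuousLinearMap.coeFn_compLp' (ContinuousLinearMap.apply ℝ ℝ v)
      (randOpL2 ρ hL hCB hbound u), coeFn_randOpL2 hL hCB hbound u,
      coeFn_tensorL2 ρ v W] with ω h1 h2 h3
    rw [h1, h2, h3, map_smul, smul_eq_mul, mul_comm]; rfl
  · refine integral_congr_ae ?_
    filter_upwards [ContinuousLinearMap.coeFn_compLp' (innerSL ℝ (ι v)) f] with ω h1
    rw [h1, innerSL_apply_apply, real_inner_comm, mul_comm]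

/-- Centring changes the residual only by a multiple of `1`, which disappears against mean-zero test
variables. -/
theorem fluct_residual_ae [IsProbabilityMeasure ρ] (hL : Measurable L) (hCB : 0 < CB)
    (hbound : ∀ ω v w, L ω v w ≤ CB * ‖v‖ * ‖w‖) (ι : V →L[ℝ] H) (f : Lp H 2 ρ)
    (u : Lp V 2 ρ) (v : V) :
    (fun ω => fluct ρ (randOp L u) ω v - inner ℝ (fluct ρ f ω) (ι v)) =ᵐ[ρ]
      (residualL2 hL hCB hbound ι f u v
        - (mean ρ (randOp L u) v - inner ℝ (mean ρ f) (ι v)) • oneL2 ρ : Lp ℝ 2 ρ) := by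
  set c := mean ρ (randOp L u) v - inner ℝ (mean ρ f) (ι v) with hc
  filter_upwards [Lp.coeFn_sub (residualL2 hL hCB hbound ι f u v) (c • oneL2 ρ),
    Lp.coeFn_smul c (oneL2 ρ), coeFn_oneL2 ρ, coeFn_residualL2 hL hCB hbound ι f u v]
    with ω h1 h2 h3 h4
  rw [h1, Pi.sub_apply, h2, Pi.smul_apply, h3, h4, hc, fluct, fluct, sub_apply,
    inner_sub_left, smul_eq_mul]
  ring

end Residual

/-! ### From the factor equations to the weak form -/

section Dynamics

variable {Γ V H : Type*} [MeasurableSpace Γ]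
  [NormedAddCommGroup V] [InnerProductSpace ℝ V] [CompleteSpace V]
  [TopologicalSpace.SeparableSpace V]
  [NormedAddCommGroup H] [InnerProductSpace ℝ H] [CompleteSpace H]
  {ρ : Measure Γ} [IsProbabilityMeasure ρ] {ι : V →L[ℝ] H}
  {L : Γ → V →L[ℝ] StrongDual ℝ V} {CB T : ℝ} {R : ℕ} {f : ℝ → Lp H 2 ρ}
  {u du : ℝ → Lp V 2 ρ}

-- Both derivatives differentiate the same scalar function `⟨ι a, ι v⟩`, so the weak derivative in
-- `V'` is represented by the strong one in `V`.
omit [CompleteSpace V] [TopologicalSpace.SeparableSpace V] [CompleteSpace H] in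
theorem inner_deriv_eq_of_hasDerivAt_toDualOf {a : ℝ → V} {a' : V} {b : StrongDual ℝ V} {t : ℝ}
    (ha : HasDerivAt a a' t) (hb : HasDerivAt (fun s => toDualOf ι (ι (a s))) b t) (v : V) :
    inner ℝ (ι a') (ι v) = b v := by
  have h1 : HasDerivAt (fun s => (inner ℝ (ι (a s)) (ι v) : ℝ)) (b v) t := by
    simpa [toDualOf] using hb.clm_apply (hasDerivAt_const t v)
  have h2 : HasDerivAt (fun s => (inner ℝ (ι (a s)) (ι v) : ℝ)) (inner ℝ (ι a') (ι v)) t := by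
    simpa using (ι.hasFDerivAt.comp_hasDerivAt t ha).inner ℝ (hasDerivAt_const t (ι v))
  exact h2.unique h1

set_option maxHeartbeats 1000000 in
/-- The DLR solution satisfies the weak form of the equation, for almost every time, tested with
`u` and with its time derivative. -/
theorem IsDLRSolution.ae_weak_form (hι : Function.Injective ι) (hL : Measurable L)
    (hCB : 0 < CB) (hbound : ∀ ω v w, L ω v w ≤ CB * ‖v‖ * ‖w‖) (hT : 0 < T)
    (hu : IsDLRSolution ρ ι L f T R u) (hdu : HasTimeDeriv T u du) :
    ∀ᵐ t ∂(volume.restrict (Ioc 0 T)),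
      (inner ℝ (embedL2 ρ ι (du t)) (embedL2 ρ ι (u t))
        = (inner ℝ (f t) (embedL2 ρ ι (u t)) : ℝ) - opForm ρ L (u t) (u t)) ∧
      (inner ℝ (embedL2 ρ ι (du t)) (embedL2 ρ ι (du t))
        = (inner ℝ (f t) (embedL2 ρ ι (du t)) : ℝ) - opForm ρ L (u t) (du t)) := by
  classical
  obtain ⟨ubar, U, Y, dubar, dU, dY, hexp, hs⟩ := hu
  have hone : ∀ s ∈ Icc 0 T, ∀ j, (inner ℝ (oneL2 ρ) (Y s j) : ℝ) = 0 := fun s hs' j => by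
    rw [inner_oneL2]; exact hs.mean_zero s hs' j
  have hexp' : ∀ s ∈ Icc 0 T, u s = tensorL2 V ρ (ubar s) (oneL2 ρ)
      + ∑ j, tensorL2 V ρ (U s j) (Y s j) := fun s hs' => by
    rw [hexp s hs', dlrExpansion_eq]
  -- Writing the factors as pairings with `u` is what makes them differentiable in `V`.
  have hubar : ∀ s ∈ Icc 0 T, ubar s = pairL2 V ρ (u s) (oneL2 ρ) := fun s hs' => by
    rw [hexp' s hs', pairL2_expansion_one ρ _ _ _ (hone s hs')]
  have hU : ∀ s ∈ Icc 0 T, ∀ j, U s j = pairL2 V ρ (u s) (Y s j) := fun s hs' j => by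
    conv_rhs => rw [hexp' s hs']
    rw [pairL2_expansion ρ _ _ _ (hs.orthonormal s hs') (hone s hs')]
  have hne : ∀ᵐ t ∂(volume.restrict (Ioc 0 T)), t ≠ T :=
    ae_restrict_of_ae (by simp [ae_iff, measure_singleton])
  filter_upwards [hs.eq_ubar, hs.eq_U, hs.eq_Y, hs.deriv_ubar.ae_hasDerivAt hT,
    ae_all_iff.2 fun j => (hs.deriv_U j).ae_hasDerivAt hT,
    ae_all_iff.2 fun j => (hs.deriv_Y j).ae_hasDerivAt hT,
    hdu.ae_hasDerivAt hT, ae_restrict_mem measurableSet_Ioc, hne]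
    with t equ eqU eqY dub dUt dYt dut htI htT
  have ht : t ∈ Icc 0 T := ⟨htI.1.le, htI.2⟩
  have hnear : ∀ᶠ s in nhds t, s ∈ Icc 0 T :=
    Icc_mem_nhds htI.1 (lt_of_le_of_ne htI.2 htT)
  set a' : V := pairL2 V ρ (du t) (oneL2 ρ) with ha'
  set U' : Fin R → V := fun j => pairL2 V ρ (u t) (dY t j) + pairL2 V ρ (du t) (Y t j) with hU'
  have da : HasDerivAt ubar a' t := by
    refine HasDerivAt.congr_of_eventuallyEq ?_ (hnear.mono hubar)
    simpa using HasDerivAt.bilinear (pairL2 V ρ) dut (hasDerivAt_const t (oneL2 ρ))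
  have dUV : ∀ j, HasDerivAt (fun s => U s j) (U' j) t := fun j =>
    HasDerivAt.congr_of_eventuallyEq (HasDerivAt.bilinear (pairL2 V ρ) dut (dYt j))
      (hnear.mono fun s hs' => hU s hs' j)
  have hdu_eq : du t = tensorL2 V ρ a' (oneL2 ρ) + ∑ j, (tensorL2 V ρ (U t j) (dY t j)
      + tensorL2 V ρ (U' j) (Y t j)) := by
    refine dut.unique (HasDerivAt.congr_of_eventuallyEq ?_ (hnear.mono hexp'))
    have h1 : HasDerivAt (fun s => tensorL2 V ρ (ubar s) (oneL2 ρ))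
        (tensorL2 V ρ a' (oneL2 ρ)) t := by
      simpa using HasDerivAt.bilinear (tensorL2 V ρ) da (hasDerivAt_const t (oneL2 ρ))
    exact h1.add (HasDerivAt.fun_sum fun j _ =>
      HasDerivAt.bilinear (tensorL2 V ρ) (dUV j) (dYt j))
  -- The means of the `Y_j` vanish throughout a neighbourhood of `t`, so those of their derivatives
  -- vanish at `t`.
  have hm' : ∀ j, (inner ℝ (oneL2 ρ) (dY t j) : ℝ) = 0 := fun j => by
    have h1 : HasDerivAt (fun s => (inner ℝ (oneL2 ρ) (Y s j) : ℝ))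
        (inner ℝ (oneL2 ρ) (dY t j)) t := by
      simpa using (hasDerivAt_const t (oneL2 ρ)).inner ℝ (dYt j)
    exact h1.unique ((hasDerivAt_const t (0 : ℝ)).congr_of_eventuallyEq
      (hnear.mono fun s hs' => hone s hs' j))
  set F : Lp V 2 ρ →L[ℝ] ℝ :=
    (innerSL ℝ (f t)).comp (embedL2L ρ ι) - opFormL ρ hL hCB hbound (u t) with hF
  have hFv : ∀ v, F v = inner ℝ (f t) (embedL2 ρ ι v) - opForm ρ L (u t) v := fun v => by
    rw [hF, sub_apply, opFormL_apply]; rfl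
  have hpair : ∀ (v : V) (Z : Lp ℝ 2 ρ), F (tensorL2 V ρ v Z)
      = inner ℝ (mean ρ fun ω => Z ω • f t ω) (ι v)
        - mean ρ (fun ω => Z ω • randOp L (u t) ω) v := fun v Z => by
    rw [hFv, opForm_tensorL2 hL hCB hbound, embedL2_tensorL2, ← inner_pairL2, pairL2_apply]
    rfl
  obtain ⟨hY', hYW⟩ := inner_dY_eq (hs.orthonormal t ht)
    (isUnit_det_gramH ι hι (hs.linIndep t ht)) _
    (fun i => fluct_residual_ae hL hCB hbound ι (f t) (u t) (U t i)) eqY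
  have h1 : ∀ v, inner ℝ (ι a') (ι v) = F (tensorL2 V ρ v (oneL2 ρ)) := fun v => by
    rw [inner_deriv_eq_of_hasDerivAt_toDualOf da dub v, hpair, eq_sub_iff_add_eq]
    have e1 : mean ρ (fun ω => oneL2 ρ ω • randOp L (u t) ω) = mean ρ (randOp L (u t)) :=
      integral_congr_ae (by filter_upwards [coeFn_oneL2 ρ] with ω h; rw [h, one_smul])
    have e2 : mean ρ (fun ω => oneL2 ρ ω • f t ω) = mean ρ (f t) :=
      integral_congr_ae (by filter_upwards [coeFn_oneL2 ρ] with ω h; rw [h, one_smul])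
    rw [e1, e2]; exact equ v
  have h2 : ∀ k v, inner ℝ (ι (U' k)) (ι v) = F (tensorL2 V ρ v (Y t k)) := fun k v => by
    rw [inner_deriv_eq_of_hasDerivAt_toDualOf (dUV k) (dUt k) v, hpair, eq_sub_iff_add_eq]
    exact eqU k v
  have h3 : ∀ k (W : Lp ℝ 2 ρ), (inner ℝ (oneL2 ρ) W : ℝ) = 0 →
      (∀ i, (inner ℝ (Y t i) W : ℝ) = 0) →
      ∑ i, inner ℝ (ι (U t i)) (ι (U t k)) * (inner ℝ (dY t i) W : ℝ)
        = F (tensorL2 V ρ (U t k) W) := fun k W hW1 hWY => by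
    have := hYW k W hWY
    rw [inner_sub_left, inner_smul_left, hW1, mul_zero, sub_zero, inner_residualL2, neg_sub,
      ← hFv] at this
    rw [← this]
    refine Finset.sum_congr rfl fun i _ => ?_
    rw [gramH, Matrix.of_apply, real_inner_comm]
  rw [← hFv, ← hFv]
  constructor
  -- `u` is tangent to the manifold at itself: `b = ū`, `B = U`, `W = 0`.
  · refine inner_embedL2_tangent ρ ι F a' (U t) U' (Y t) (dY t) (hs.orthonormal t ht)
      (hone t ht) hm' hY' h1 h2 h3 (ubar t) (U t) (fun _ => 0) (by simp) (by simp) hdu_eq ?_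
    simpa using hexp' t ht
  · exact inner_embedL2_tangent ρ ι F a' (U t) U' (Y t) (dY t) (hs.orthonormal t ht)
      (hone t ht) hm' hY' h1 h2 h3 a' U' (dY t) hm' hY' hdu_eq hdu_eq

end Dynamics

end

/-! ### The stability estimates -/

theorem mainTheorem6 {Γ V H : Type*} [MeasurableSpace Γ]
    [NormedAddCommGroup V] [InnerProductSpace ℝ V] [CompleteSpace V]
    [TopologicalSpace.SeparableSpace V]
    [NormedAddCommGroup H] [InnerProductSpace ℝ H] [CompleteSpace H]
    [TopologicalSpace.SeparableSpace H]
    (ρ : Measure Γ) [IsProbabilityMeasure ρ]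
    (ι : V →L[ℝ] H) (hι_inj : Function.Injective ι) (hι_dense : DenseRange ι)
    (CP : ℝ) (hCP : 0 < CP) (hι : ∀ v, ‖ι v‖ ≤ CP * ‖v‖)
    (L : Γ → V →L[ℝ] StrongDual ℝ V) (hL : Measurable L)
    (CL CB : ℝ) (hCL : 0 < CL) (hCB : 0 < CB)
    (hcoer : ∀ ω v, CL * ‖v‖ ^ 2 ≤ L ω v v)
    (hbound : ∀ ω v w, L ω v w ≤ CB * ‖v‖ * ‖w‖)
    (T : ℝ) (hT : 0 < T)
    (f : ℝ → Lp H 2 ρ) (hf : IsL2Time T f)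
    (R : ℕ) (u du : ℝ → Lp V 2 ρ)
    (hu : IsDLRSolution ρ ι L f T R u)
    (hu2 : IsL2Time T u) (hdu : HasTimeDeriv T u du) (hdu2 : IsL2Time T du) :
    (‖embedL2 ρ ι (u T)‖ ^ 2 + CL * ∫ t in (0 : ℝ)..T, ‖u t‖ ^ 2
      ≤ ‖embedL2 ρ ι (u 0)‖ ^ 2 + CP ^ 2 / CL * ∫ t in (0 : ℝ)..T, ‖f t‖ ^ 2) ∧
    ((∀ v w : Lp V 2 ρ, opForm ρ L v w = opForm ρ L w v) →
      opNorm ρ L (u T) ^ 2 + ∫ t in (0 : ℝ)..T, ‖embedL2 ρ ι (du t)‖ ^ 2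
        ≤ opNorm ρ L (u 0) ^ 2 + ∫ t in (0 : ℝ)..T, ‖f t‖ ^ 2) ∧
    ((∀ᵐ t ∂(volume.restrict (Ioc 0 T)), f t = 0) →
      ∀ t₁ ∈ Icc (0 : ℝ) T, ∀ t₂ ∈ Icc (0 : ℝ) T, t₁ ≤ t₂ →
        ‖embedL2 ρ ι (u t₂)‖ ≤ ‖embedL2 ρ ι (u t₁)‖ ∧
        ((∀ v w : Lp V 2 ρ, opForm ρ L v w = opForm ρ L w v) →
          opNorm ρ L (u t₂) ≤ opNorm ρ L (u t₁))) := by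
  have hweak := hu.ae_weak_form hι_inj hL hCB hbound hT hdu
  have h0 : (0 : ℝ) ∈ Icc 0 T := ⟨le_rfl, hT.le⟩
  have hTT : T ∈ Icc 0 T := ⟨hT.le, le_rfl⟩
  have iu := hu2.integrableOn_norm_sq
  have jf := hf.integrableOn_norm_sq
  have idu : IntegrableOn (fun t => ‖embedL2 ρ ι (du t)‖ ^ 2) (Ioc 0 T) :=
    IsL2Time.integrableOn_norm_sq (w := fun t => embedL2 ρ ι (du t))
      ((embedL2L ρ ι).comp_memLp' hdu2)
  have energyH : ∀ t₁ ∈ Icc (0 : ℝ) T, ∀ t₂ ∈ Icc (0 : ℝ) T, t₁ ≤ t₂ →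
      ‖embedL2 ρ ι (u t₂)‖ ^ 2 + CL * ∫ t in t₁..t₂, ‖u t‖ ^ 2
        ≤ ‖embedL2 ρ ι (u t₁)‖ ^ 2 + CP ^ 2 / CL * ∫ t in t₁..t₂, ‖f t‖ ^ 2 := by
    intro t₁ h₁ t₂ h₂ h₁₂
    have hB : ∀ v w, (innerSL ℝ).bilinearComp (embedL2L ρ ι) (embedL2L ρ ι) v w
        = (inner ℝ (embedL2 ρ ι v) (embedL2 ρ ι w) : ℝ) := fun v w => rfl
    have := hdu.energy_le hT ((innerSL ℝ).bilinearComp (embedL2L ρ ι) (embedL2L ρ ι))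
      (iu.const_mul CL) (jf.const_mul (CP ^ 2 / CL)) ?_ h₁ h₂ h₁₂
    · simpa only [hB, real_inner_self_eq_norm_sq, intervalIntegral.integral_const_mul] using this
    · filter_upwards [hweak] with t ht
      rw [hB, hB, real_inner_comm, ht.1]
      have c1 := le_opForm hL hCB hbound hcoer (u t)
      have c2 := (real_inner_le_norm (f t) (embedL2 ρ ι (u t))).trans
        (mul_le_mul_of_nonneg_left (norm_embedL2_le ρ ι hι (u t)) (norm_nonneg _))
      -- Young's inequality as a completed square: of the dissipation `2 CL ‖u‖²` from coercivity,
      -- one half absorbs the forcing and the other half remains on the left.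
      have c3 : CP ^ 2 / CL * ‖f t‖ ^ 2 + CL * ‖u t‖ ^ 2 - 2 * (‖f t‖ * (CP * ‖u t‖))
          = (CP * ‖f t‖ - CL * ‖u t‖) ^ 2 / CL := by field_simp; ring
      have c4 : 0 ≤ (CP * ‖f t‖ - CL * ‖u t‖) ^ 2 / CL := by positivity
      linarith
  have energyL : (∀ v w : Lp V 2 ρ, opForm ρ L v w = opForm ρ L w v) →
      ∀ t₁ ∈ Icc (0 : ℝ) T, ∀ t₂ ∈ Icc (0 : ℝ) T, t₁ ≤ t₂ →
      opNorm ρ L (u t₂) ^ 2 + ∫ t in t₁..t₂, ‖embedL2 ρ ι (du t)‖ ^ 2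
        ≤ opNorm ρ L (u t₁) ^ 2 + ∫ t in t₁..t₂, ‖f t‖ ^ 2 := by
    intro hsym t₁ h₁ t₂ h₂ h₁₂
    rw [opNorm_sq hCL hL hCB hbound hcoer, opNorm_sq hCL hL hCB hbound hcoer,
      ← opFormL_apply hL hCB hbound, ← opFormL_apply hL hCB hbound]
    refine hdu.energy_le hT _ idu jf ?_ h₁ h₂ h₁₂
    filter_upwards [hweak] with t ht
    -- Symmetry merges the two cross terms into `2⟨u, u'⟩_{𝓛,ρ}`, which the equation tested with
    -- `u'` equates with `2⟨f, u'⟩ - 2‖u'‖²` in the `H` inner product and norm.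
    rw [opFormL_apply, opFormL_apply, hsym (du t) (u t)]
    have c1 := ht.2
    rw [real_inner_self_eq_norm_sq] at c1
    have c2 := real_inner_le_norm (f t) (embedL2 ρ ι (du t))
    have c3 := two_mul_le_add_sq ‖f t‖ ‖embedL2 ρ ι (du t)‖
    linarith
  refine ⟨energyH 0 h0 T hTT hT.le, fun hsym => energyL hsym 0 h0 T hTT hT.le, ?_⟩
  intro hf0 t₁ h₁ t₂ h₂ h₁₂
  have hfint : ∫ t in t₁..t₂, ‖f t‖ ^ 2 = 0 := by
    rw [intervalIntegral.integral_of_le h₁₂]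
    refine integral_eq_zero_of_ae ?_
    filter_upwards [ae_restrict_of_ae_restrict_of_subset (Ioc_subset_Ioc h₁.1 h₂.2) hf0] with t ht
    simp [ht]
  constructor
  · have h := energyH t₁ h₁ t₂ h₂ h₁₂
    have : 0 ≤ CL * ∫ t in t₁..t₂, ‖u t‖ ^ 2 :=
      mul_nonneg hCL.le (intervalIntegral.integral_nonneg h₁₂ fun _ _ => by positivity)
    rw [hfint, mul_zero] at h
    exact le_of_sq_le_sq (by linarith) (norm_nonneg _)
  · intro hsym
    have h := energyL hsym t₁ h₁ t₂ h₂ h₁₂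
    have : 0 ≤ ∫ t in t₁..t₂, ‖embedL2 ρ ι (du t)‖ ^ 2 :=
      intervalIntegral.integral_nonneg h₁₂ fun _ _ => by positivity
    rw [hfint] at h
    exact le_of_sq_le_sq (by linarith) (Real.sqrt_nonneg _)
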